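/- Let $K$ be a field of characteristic different from $2$ and $3$. A $K$-algebra $L$ with bilinear multiplication $[\cdot,\cdot]$ is \emph{anticommutative} if $[x,x]=0$ for all $x\in L$; put $J(x,y,z)=[[x,y],z]+[[z,x],y]+[[y,z],x]$. An \emph{$\omega$-Lie algebra} over $K$ is an anticommutative $K$-algebra $L$ for which there is a bilinear form $\omega:L\times L\to K$ such that $$J(x,y,z)=\omega(x,y)z+\omega(z,x)y+\omega(y,z)x\qquad\text{for all }x,y,z\in L.$$ An \emph{identity} is an equation $f=0$ with $f$ a nonassociative polynomial over $K$ (an element of the free nonassociative $K$-algebra without unit on countably many variables); its degree is the largest length of a monomial occurring in $f$, an algebra satisfies it if $f$ vanishes under all substitutions of elements of the algebra for the variables, and it is \emph{nontrivial} if it is not satisfied by all anticommutative $K$-algebras. Then the minimal degree of a nontrivial identity satisfied by all $\omega$-Lie algebras over $K$ is $5$. More precisely: (1) The identity of degree $5$ $$\sum_{\sigma\in S_5}(-1)^\sigma\Big([[[[x_{\sigma(1)},x_{\sigma(2)}],x_{\sigma(3)}],x_{\sigma(4)}],x_{\sigma(5)}]+[[[x_{\sigma(1)},x_{\sigma(2)}],x_{\sigma(3)}],[x_{\sigma(4)},x_{\sigma(5)}]]\Big)=0$$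 is nontrivial and is satisfied by all $\omega$-Lie algebras over $K$. (2) No nontrivial identity of degree $\le 4$ is satisfied by all $\omega$-Lie algebras over $K$. In particular, each of the following identities fails in some $\omega$-Lie algebra over $K$: $[[[y,x],x],x]=0$; $$\alpha[[x,y],[x,z]]+\beta\big([[[x,y],x],z]-[[[x,z],x],y]\big)+\gamma\big([[[x,y],z],x]-[[[x,z],y],x]\big)+(\beta+\gamma)[[[y,z],x],x]=0,$$ for any fixed $\alpha,\beta,\gamma\in K$ not all zero; $J(x,y,[x,y])=0$; and $$[J(x,y,z),t]-[J(t,x,y),z]+[J(z,t,x),y]-[J(y,z,t),x]=0.$$ -/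

import Mathlib

universe u v

namespace OmegaLie

/-- An algebra with multiplication `x * y` (written `[x, y]` on paper) is anticommutative if
`[x, x] = 0` for all `x`; away from characteristic `2` this is the same as `[x, y] = -[y, x]`. -/
def IsAnticommutative (L : Type v) [NonUnitalNonAssocRing L] : Prop :=
  ∀ x : L, x * x = 0

/-- The Jacobian `J(x, y, z) = [[x, y], z] + [[z, x], y] + [[y, z], x]`. -/
def jacobian {L : Type v} [NonUnitalNonAssocRing L] (x y z : L) : L :=
  (x * y) * z + (z * x) * y + (y * z) * x

/-- `ω`-Lie algebras over `K`: anticommutative `K`-algebras `L` for which there is a bilinear form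
`ω` such that `J(x, y, z) = ω(x, y) z + ω(z, x) y + ω(y, z) x`. -/
structure IsOmegaLieAlgebra (K : Type u) (L : Type v) [Field K] [NonUnitalNonAssocRing L]
    [Module K L] : Prop where
  anticommutative : IsAnticommutative L
  exists_form : ∃ ω : LinearMap.BilinForm K L, ∀ x y z : L,
    jacobian x y z = ω x y • z + ω z x • y + ω y z • x

/-- Nonassociative polynomials over `K` in countably many variables. -/
abbrev Poly (K : Type u) [Field K] : Type u := FreeNonUnitalNonAssocAlgebra K ℕ

/-- The `i`-th variable. -/
noncomputable abbrev var (K : Type u) [Field K] (i : ℕ) : Poly K :=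
  FreeNonUnitalNonAssocAlgebra.of K i

section

variable {K : Type u} [Field K]

/-- The degree of a nonassociative polynomial: the largest length of a monomial that occurs in
it. -/
def degree (f : Poly K) : ℕ := f.coeff.support.sup FreeMagma.length

/-- `f = 0` is an identity of the algebra `L`: it holds under all substitutions of elements of `L`
for the variables. -/
def Satisfies (L : Type v) [NonUnitalNonAssocRing L] [Module K L] [IsScalarTower K L L]
    [SMulCommClass K L L] (f : Poly K) : Prop :=
  ∀ a : ℕ → L, FreeNonUnitalNonAssocAlgebra.lift K a f = 0

/-- `f = 0` holds in all anticommutative `K`-algebras, that is, `f` is zero in the free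
anticommutative algebra (which lives in the universe of `K`). -/
def IsTrivialIdentity (f : Poly K) : Prop :=
  ∀ (A : Type u) [NonUnitalNonAssocRing A] [Module K A] [IsScalarTower K A A]
    [SMulCommClass K A A], IsAnticommutative A → Satisfies A f

/-- `f = 0` is satisfied by all `ω`-Lie algebras over `K`. -/
def HoldsInOmegaLieAlgebras (f : Poly K) : Prop :=
  ∀ (L : Type (max u v)) [NonUnitalNonAssocRing L] [Module K L] [IsScalarTower K L L]
    [SMulCommClass K L L], IsOmegaLieAlgebra K L → Satisfies L f

end

section

variable (K : Type u) [Field K]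

/-- `∑ (-1)^σ ([[[[x_σ(1), x_σ(2)], x_σ(3)], x_σ(4)], x_σ(5)]`
`+ [[[x_σ(1), x_σ(2)], x_σ(3)], [x_σ(4), x_σ(5)]])`, summed over the permutations of five
letters. -/
noncomputable def quinticPoly : Poly K :=
  ∑ σ : Equiv.Perm (Fin 5), (Equiv.Perm.sign σ : ℤ) •
    ((((var K (σ 0) * var K (σ 1)) * var K (σ 2)) * var K (σ 3)) * var K (σ 4)
      + ((var K (σ 0) * var K (σ 1)) * var K (σ 2)) * (var K (σ 3) * var K (σ 4)))

/-- `[[[y, x], x], x]` with `x`, `y` the variables `0`, `1`. -/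
noncomputable def engelPoly : Poly K :=
  let x := var K 0
  let y := var K 1
  ((y * x) * x) * x

/-- `α[[x,y],[x,z]] + β([[[x,y],x],z] - [[[x,z],x],y]) + γ([[[x,y],z],x] - [[[x,z],y],x])`
`+ (β + γ)[[[y,z],x],x]` with `x`, `y`, `z` the variables `0`, `1`, `2`. -/
noncomputable def threeParamPoly (α β γ : K) : Poly K :=
  let x := var K 0
  let y := var K 1
  let z := var K 2
  α • ((x * y) * (x * z))
    + β • (((x * y) * x) * z - ((x * z) * x) * y)
    + γ • (((x * y) * z) * x - ((x * z) * y) * x)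
    + (β + γ) • (((y * z) * x) * x)

/-- `J(x, y, [x, y])` with `x`, `y` the variables `0`, `1`. -/
noncomputable def binaryLiePoly : Poly K :=
  let x := var K 0
  let y := var K 1
  jacobian x y (x * y)

/-- `[J(x,y,z),t] - [J(t,x,y),z] + [J(z,t,x),y] - [J(y,z,t),x]` with `x`, `y`, `z`, `t` the
variables `0`, `1`, `2`, `3`. -/
noncomputable def alternatingJacobianPoly : Poly K :=
  let x := var K 0
  let y := var K 1
  let z := var K 2
  let t := var K 3
  jacobian x y z * t - jacobian t x y * z + jacobian z t x * y - jacobian y z t * x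

end

end OmegaLie

/-! One four-dimensional ω-Lie algebra, `CyclicAlg`, excludes every nontrivial identity of degree at
most 4. Modulo anticommutativity a polynomial of that degree is a combination of left-normed
monomials and of products of two commutators (`HasNormalForm`). Substituting `t • a` for `t = ±1,
±2` separates its homogeneous components, since the determinants involved have only the prime
factors 2 and 3. Each component is polarized by inclusion–exclusion (`sum_neg_one_pow_multiEval`)
and can be recovered from its polarizations because n! is invertible (`factorial_smul_multiEval`).
It then suffices that the multilinear monomials in distinct variables (1, 1, 3 and 15 in degrees 1
to 4) are independent as functions on `CyclicAlg`; degree 4 is `cyclicAlg_quartic_independent`. All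
the vanishing coefficients are independent of the algebra, so the identity holds in every
anticommutative algebra. The named identities of low degree are refuted by direct evaluation on
`CyclicAlg`.

For the quintic, sum the summand cyclically over its first three letters. The Jacobian appears and
is replaced by ω, so that each ω(x, y) multiplies [[z, t], s] - [[t, s], z]. These two terms differ
by a 3-cycle of the letters, which is even, so they cancel in the alternating sum; three times the
quintic is therefore 0. Nontriviality is seen in a nilpotent algebra built around a single word of
length 5 (`chainMul`). -/

namespace OmegaLie

/-! ### Algebras defined by a bilinear map -/

section BilinAlg

variable {K : Type u} [Field K] {V : Type v} [AddCommGroup V] [Module K V]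

/-- The vector space `V` with the multiplication given by a bilinear map. -/
def BilinAlg (_ : V →ₗ[K] V →ₗ[K] V) : Type v := V

variable (μ : V →ₗ[K] V →ₗ[K] V)

instance : AddCommGroup (BilinAlg μ) := inferInstanceAs (AddCommGroup V)

instance : Module K (BilinAlg μ) := inferInstanceAs (Module K V)

instance : NonUnitalNonAssocRing (BilinAlg μ) :=
  { (inferInstance : AddCommGroup (BilinAlg μ)) with
    mul := fun x y => μ x y
    left_distrib := fun x y z => (μ x).map_add y z
    right_distrib := fun x y z => LinearMap.map_add₂ μ x y z
    zero_mul := fun x => LinearMap.map_zero₂ μ x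
    mul_zero := fun x => (μ x).map_zero }

instance : IsScalarTower K (BilinAlg μ) (BilinAlg μ) :=
  ⟨fun r x y => LinearMap.map_smul₂ μ r x y⟩

instance : SMulCommClass K (BilinAlg μ) (BilinAlg μ) :=
  ⟨fun r x y => ((μ x).map_smul r y).symm⟩

end BilinAlg

/-! ### Anticommutativity and change of universe -/

section Basic

variable {K : Type u} [Field K]

theorem IsAnticommutative.mul_comm_neg {A : Type v} [NonUnitalNonAssocRing A]
    (h : IsAnticommutative A) (x y : A) : x * y = -(y * x) := by
  have := h (x + y)
  simp only [mul_add, add_mul, h x, h y, zero_add, add_zero] at this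
  exact eq_neg_of_add_eq_zero_right this

/-- An identity of all `ω`-Lie algebras in the larger universe holds in those in the universe
of `K`. -/
theorem HoldsInOmegaLieAlgebras.satisfies {f : Poly K}
    (hf : HoldsInOmegaLieAlgebras.{u, v} f) {L : Type u} [NonUnitalNonAssocRing L] [Module K L]
    [IsScalarTower K L L] [SMulCommClass K L L] (hL : IsOmegaLieAlgebra K L) :
    Satisfies L f := by
  intro a
  have : IsScalarTower K (ULift.{v} L) (ULift.{v} L) :=
    ⟨fun r x y => ULift.ext _ _ (smul_mul_assoc r x.down y.down)⟩
  have : SMulCommClass K (ULift.{v} L) (ULift.{v} L) :=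
    ⟨fun r x y => ULift.ext _ _ (mul_smul_comm r x.down y.down).symm⟩
  let φ : ULift.{v} L →ₙₐ[K] L :=
    { toFun := ULift.down
      map_smul' := fun _ _ => rfl
      map_zero' := rfl
      map_add' := fun _ _ => rfl
      map_mul' := fun _ _ => rfl }
  have hU : IsOmegaLieAlgebra K (ULift.{v} L) := by
    obtain ⟨ω, hω⟩ := hL.exists_form
    refine ⟨fun x => ULift.ext _ _ (hL.anticommutative x.down),
      ω.compl₁₂ (φ : ULift.{v} L →ₗ[K] L) (φ : ULift.{v} L →ₗ[K] L), fun x y z => ?_⟩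
    exact ULift.ext _ _ (hω x.down y.down z.down)
  have h := congrArg φ (hf (ULift.{v} L) hU fun i => ULift.up (a i))
  have hc : φ.comp (FreeNonUnitalNonAssocAlgebra.lift K fun i => ULift.up.{v} (a i))
      = FreeNonUnitalNonAssocAlgebra.lift K a := by
    refine FreeNonUnitalNonAssocAlgebra.hom_ext K fun i => ?_
    rw [FreeNonUnitalNonAssocAlgebra.lift_of_apply, NonUnitalAlgHom.comp_apply,
      FreeNonUnitalNonAssocAlgebra.lift_of_apply]
    rfl
  rw [← hc]
  exact h

end Basic

/-! ### The four-dimensional cyclic ω-Lie algebra -/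

section CyclicAlg

variable (K : Type u) [Field K]

/-- The multiplication `e₀e₁ = e₀`, `e₁e₂ = e₁`, `e₂e₀ = e₂`, `e₃eᵢ = e₃` for `i < 3` on a
four-dimensional space. -/
def cyclicMul : (Fin 4 → K) →ₗ[K] (Fin 4 → K) →ₗ[K] (Fin 4 → K) :=
  LinearMap.mk₂ K (fun x y => ![x 0 * y 1 - x 1 * y 0, x 1 * y 2 - x 2 * y 1,
      x 2 * y 0 - x 0 * y 2, x 3 * (y 0 + y 1 + y 2) - (x 0 + x 1 + x 2) * y 3])
    (fun x x' y => by ext i; fin_cases i <;> simp <;> ring)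
    (fun c x y => by ext i; fin_cases i <;> simp <;> ring)
    (fun x y y' => by ext i; fin_cases i <;> simp <;> ring)
    (fun c x y => by ext i; fin_cases i <;> simp <;> ring)

theorem cyclicMul_apply (x y : Fin 4 → K) : cyclicMul K x y =
    ![x 0 * y 1 - x 1 * y 0, x 1 * y 2 - x 2 * y 1, x 2 * y 0 - x 0 * y 2,
      x 3 * (y 0 + y 1 + y 2) - (x 0 + x 1 + x 2) * y 3] := rfl

/-- The form of the cyclic algebra: minus the sum of the first three coordinates of the product. -/
def cyclicForm : LinearMap.BilinForm K (Fin 4 → K) :=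
  LinearMap.mk₂ K (fun x y => -((x 0 * y 1 - x 1 * y 0) + (x 1 * y 2 - x 2 * y 1) +
      (x 2 * y 0 - x 0 * y 2)))
    (fun x x' y => by simp; ring)
    (fun c x y => by simp; ring)
    (fun x y y' => by simp; ring)
    (fun c x y => by simp; ring)

theorem cyclicForm_apply (x y : Fin 4 → K) : cyclicForm K x y =
    -((x 0 * y 1 - x 1 * y 0) + (x 1 * y 2 - x 2 * y 1) + (x 2 * y 0 - x 0 * y 2)) := rfl

theorem cyclicMul_self (x : Fin 4 → K) : cyclicMul K x x = 0 := by
  rw [cyclicMul_apply]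
  ext i
  fin_cases i <;> simp <;> ring

/-- The vector `e₃` forces the form: with λ the sum of the first three coordinates, e₃x = λ(x)e₃ for
x in the span of `e₀`, `e₁`, `e₂`. So in J(x, y, e₃) two terms cancel and -λ(xy)e₃ remains, whence
ω(x, y) = -λ(xy). On the other basis vectors J(e₀, e₁, e₂) = -(e₀ + e₁ + e₂) agrees with this form.
-/
theorem cyclicMul_jacobian (x y z : Fin 4 → K) :
    cyclicMul K (cyclicMul K x y) z + cyclicMul K (cyclicMul K z x) y +
      cyclicMul K (cyclicMul K y z) x =
    cyclicForm K x y • z + cyclicForm K z x • y + cyclicForm K y z • x := by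
  simp only [cyclicMul_apply, cyclicForm_apply]
  ext i
  fin_cases i <;> simp <;> ring

/-- A four-dimensional `ω`-Lie algebra without nontrivial identities of degree at most `4`. -/
abbrev CyclicAlg : Type u := BilinAlg (cyclicMul K)

theorem isOmegaLieAlgebra_cyclicAlg : IsOmegaLieAlgebra K (CyclicAlg K) :=
  ⟨cyclicMul_self K, cyclicForm K, cyclicMul_jacobian K⟩

/-- The basis vector `e₀` of the cyclic algebra. -/
def e₀ : CyclicAlg K := (![1, 0, 0, 0] : Fin 4 → K)

/-- The basis vector `e₁` of the cyclic algebra. -/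
def e₁ : CyclicAlg K := (![0, 1, 0, 0] : Fin 4 → K)

/-- The basis vector `e₂` of the cyclic algebra. -/
def e₂ : CyclicAlg K := (![0, 0, 1, 0] : Fin 4 → K)

/-- The basis vector `e₃` of the cyclic algebra. -/
def e₃ : CyclicAlg K := (![0, 0, 0, 1] : Fin 4 → K)

@[simp]
theorem e₀_mul_e₁ : e₀ K * e₁ K = e₀ K := by
  change cyclicMul K ![1, 0, 0, 0] ![0, 1, 0, 0] = ![1, 0, 0, 0]
  simp [cyclicMul_apply]

@[simp]
theorem e₁_mul_e₂ : e₁ K * e₂ K = e₁ K := by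
  change cyclicMul K ![0, 1, 0, 0] ![0, 0, 1, 0] = ![0, 1, 0, 0]
  simp [cyclicMul_apply]

@[simp]
theorem e₂_mul_e₀ : e₂ K * e₀ K = e₂ K := by
  change cyclicMul K ![0, 0, 1, 0] ![1, 0, 0, 0] = ![0, 0, 1, 0]
  simp [cyclicMul_apply]

@[simp]
theorem e₃_mul_e₀ : e₃ K * e₀ K = e₃ K := by
  change cyclicMul K ![0, 0, 0, 1] ![1, 0, 0, 0] = ![0, 0, 0, 1]
  simp [cyclicMul_apply]

@[simp]
theorem e₃_mul_e₁ : e₃ K * e₁ K = e₃ K := by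
  change cyclicMul K ![0, 0, 0, 1] ![0, 1, 0, 0] = ![0, 0, 0, 1]
  simp [cyclicMul_apply]

@[simp]
theorem e₃_mul_e₂ : e₃ K * e₂ K = e₃ K := by
  change cyclicMul K ![0, 0, 0, 1] ![0, 0, 1, 0] = ![0, 0, 0, 1]
  simp [cyclicMul_apply]

@[simp]
theorem e₁_mul_e₀ : e₁ K * e₀ K = -e₀ K := by
  rw [(isOmegaLieAlgebra_cyclicAlg K).anticommutative.mul_comm_neg, e₀_mul_e₁]

@[simp]
theorem e₂_mul_e₁ : e₂ K * e₁ K = -e₁ K := by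
  rw [(isOmegaLieAlgebra_cyclicAlg K).anticommutative.mul_comm_neg, e₁_mul_e₂]

@[simp]
theorem e₀_mul_e₂ : e₀ K * e₂ K = -e₂ K := by
  rw [(isOmegaLieAlgebra_cyclicAlg K).anticommutative.mul_comm_neg, e₂_mul_e₀]

@[simp]
theorem e₀_mul_e₃ : e₀ K * e₃ K = -e₃ K := by
  rw [(isOmegaLieAlgebra_cyclicAlg K).anticommutative.mul_comm_neg, e₃_mul_e₀]

@[simp]
theorem e₁_mul_e₃ : e₁ K * e₃ K = -e₃ K := by
  rw [(isOmegaLieAlgebra_cyclicAlg K).anticommutative.mul_comm_neg, e₃_mul_e₁]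

@[simp]
theorem e₂_mul_e₃ : e₂ K * e₃ K = -e₃ K := by
  rw [(isOmegaLieAlgebra_cyclicAlg K).anticommutative.mul_comm_neg, e₃_mul_e₂]

@[simp]
theorem cyclicAlg_mul_self (x : CyclicAlg K) : x * x = 0 :=
  (isOmegaLieAlgebra_cyclicAlg K).anticommutative x

variable {K}

theorem cyclicAlg_linearIndependent {a b c d : K}
    (h : a • e₀ K + b • e₁ K + c • e₂ K + d • e₃ K = 0) : a = 0 ∧ b = 0 ∧ c = 0 ∧ d = 0 := by
  have h' : a • ![1, 0, 0, 0] + b • ![0, 1, 0, 0] + c • ![0, 0, 1, 0] + d • ![0, 0, 0, 1]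
      = (0 : Fin 4 → K) := h
  refine ⟨?_, ?_, ?_, ?_⟩
  · simpa using congrFun h' 0
  · simpa using congrFun h' 1
  · simpa using congrFun h' 2
  · simpa using congrFun h' 3

end CyclicAlg

/-! ### Polarization of combinations of multilinear monomials -/

section Polarization

variable {K : Type u} [Field K] {V W : Type*} [AddCommGroup V] [Module K V]
  [AddCommGroup W] [Module K W] {n : ℕ}

/-- Inclusion–exclusion: expand the product over j of 1 + x_j, where x_j is 0 if j is in the range
of r and -1 otherwise. A factor vanishes exactly when r misses some j, and a self-map of a finite
set is bijective as soon as it is surjective. -/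
theorem sum_finset_neg_one_pow_range_subset (r : Fin n → Fin n) :
    ∑ S : Finset (Fin n), (if ∀ i, r i ∈ S then (-1 : ℤ) ^ Sᶜ.card else 0) =
      if Function.Bijective r then 1 else 0 := by
  have h := Finset.prod_add (fun _ : Fin n => (1 : ℤ))
    (fun j => if ∃ i, r i = j then 0 else -1) Finset.univ
  have hl : ∏ j : Fin n, ((1 : ℤ) + if ∃ i, r i = j then 0 else -1) =
      if Function.Bijective r then 1 else 0 := by
    split_ifs with hr
    · refine Finset.prod_eq_one fun j _ => ?_
      rw [if_pos (hr.2 j), add_zero]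
    · have hs : ¬ Function.Surjective r := fun hs => hr ⟨Finite.injective_iff_surjective.2 hs, hs⟩
      obtain ⟨j, hj⟩ := not_forall.1 hs
      refine Finset.prod_eq_zero (Finset.mem_univ j) ?_
      rw [if_neg hj, add_neg_cancel]
  rw [← hl, h, Finset.powerset_univ]
  refine Finset.sum_congr rfl fun S _ => ?_
  rw [Finset.prod_const_one, one_mul, ← Finset.compl_eq_univ_sdiff]
  split_ifs with hS
  · rw [Finset.prod_congr rfl (g := fun _ => (-1 : ℤ)), Finset.prod_const]
    intro j hj
    refine if_neg ?_
    rintro ⟨i, rfl⟩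
    exact Finset.mem_compl.1 hj (hS i)
  · obtain ⟨i, hi⟩ := not_forall.1 hS
    refine (Finset.prod_eq_zero (i := r i) (Finset.mem_compl.2 hi) ?_).symm
    exact if_pos ⟨i, rfl⟩

/-- The value of a linear combination of the maps `a ↦ T (a ∘ v)`. -/
def multiEval (T : MultilinearMap K (fun _ : Fin n => V) W) (c : (Fin n → ℕ) →₀ K)
    (a : ℕ → V) : W :=
  c.sum fun v r => r • T fun i => a (v i)

/-- Homogeneity, used to separate the components of different degrees. -/
theorem multiEval_smul (T : MultilinearMap K (fun _ : Fin n => V) W) (c : (Fin n → ℕ) →₀ K)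
    (t : K) (a : ℕ → V) : multiEval T c (fun i => t • a i) = t ^ n • multiEval T c a := by
  simp only [multiEval, Finsupp.sum, Finset.smul_sum]
  refine Finset.sum_congr rfl fun v _ => ?_
  rw [T.map_smul_univ (fun _ => t), Finset.prod_const, Finset.card_univ, Fintype.card_fin,
    smul_comm]

/-- Here w may repeat variables: the substitution gives variable k the sum of those y j with j in S
and w j = k. Multilinear expansion chooses one index r i for each slot, and only the word w ∘ r
survives. -/
theorem multiEval_sum_single (T : MultilinearMap K (fun _ : Fin n => V) W)
    (c : (Fin n → ℕ) →₀ K) (w : Fin n → ℕ) (y : Fin n → V) (S : Finset (Fin n)) :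
    multiEval T c (fun k => ∑ j ∈ S, (Pi.single (w j) (y j) : ℕ → V) k) =
      ∑ r : Fin n → Fin n, if ∀ i, r i ∈ S then
        c (fun i => w (r i)) • T (fun i => y (r i)) else 0 := by
  simp only [multiEval, Finsupp.sum, T.map_sum_finset, Finset.smul_sum]
  rw [Finset.sum_comm, ← Finset.sum_filter]
  have hf : (Finset.univ.filter fun r : Fin n → Fin n => ∀ i, r i ∈ S) =
      Fintype.piFinset fun _ => S := by
    ext r; simp
  rw [hf]
  refine Finset.sum_congr rfl fun r _ => ?_
  rw [Finset.sum_eq_single (fun i => w (r i))]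
  · simp
  · intro v _ hv
    obtain ⟨i, hi⟩ := Function.ne_iff.1 hv
    rw [T.map_coord_zero i (Pi.single_eq_of_ne hi _), smul_zero]
  · intro h
    rw [Finsupp.notMem_support_iff.1 h, zero_smul]

/-- The polarization of a linear combination of the maps `a ↦ T (a ∘ v)`, as an alternating sum
of its values. -/
theorem sum_neg_one_pow_multiEval (T : MultilinearMap K (fun _ : Fin n => V) W)
    (c : (Fin n → ℕ) →₀ K) (w : Fin n → ℕ) (y : Fin n → V) :
    ∑ S : Finset (Fin n), (-1 : ℤ) ^ Sᶜ.card •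
      multiEval T c (fun k => ∑ j ∈ S, (Pi.single (w j) (y j) : ℕ → V) k) =
    ∑ σ : Equiv.Perm (Fin n), c (fun i => w (σ i)) • T (fun i => y (σ i)) := by
  simp only [multiEval_sum_single, Finset.smul_sum]
  rw [Finset.sum_comm]
  have : ∀ r : Fin n → Fin n, ∑ S : Finset (Fin n), ((-1 : ℤ) ^ Sᶜ.card •
      if ∀ i, r i ∈ S then c (fun i => w (r i)) • T (fun i => y (r i)) else 0) =
      if Function.Bijective r then c (fun i => w (r i)) • T (fun i => y (r i)) else 0 := by
    intro r
    have h := congrArg (fun z : ℤ => z • (c (fun i => w (r i)) • T (fun i => y (r i))))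
      (sum_finset_neg_one_pow_range_subset r)
    simpa [Finset.sum_smul, ite_smul, smul_ite] using h
  simp only [this]
  rw [← Finset.sum_filter]
  symm
  refine Finset.sum_bij (fun σ _ => ⇑σ) ?_ ?_ ?_ ?_
  · intro σ _
    exact Finset.mem_filter.2 ⟨Finset.mem_univ _, σ.bijective⟩
  · intro σ _ τ _ h
    exact DFunLike.coe_injective h
  · intro r hr
    exact ⟨Equiv.ofBijective r (Finset.mem_filter.1 hr).2, Finset.mem_univ _, rfl⟩
  · intro σ _
    rfl

/-- Up to the factor `n!`, a linear combination of the maps `a ↦ T (a ∘ v)` is a sum of values of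
its polarization. -/
theorem factorial_smul_multiEval (T : MultilinearMap K (fun _ : Fin n => V) W)
    (c : (Fin n → ℕ) →₀ K) {X : Finset (Fin n → ℕ)} (hc : c.support ⊆ X)
    (hX : ∀ w ∈ X, ∀ σ : Equiv.Perm (Fin n), (fun i => w (σ i)) ∈ X) (a : ℕ → V) :
    (n.factorial : K) • multiEval T c a =
      ∑ w ∈ X, ∑ σ : Equiv.Perm (Fin n), c (fun i => w (σ i)) • T (fun i => a (w (σ i))) := by
  -- As X is stable under permuting the slots, each σ merely reindexes the sum over X, so all n! of
  -- these sums are equal.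
  have key : ∀ σ : Equiv.Perm (Fin n),
      ∑ w ∈ X, c (fun i => w (σ i)) • T (fun i => a (w (σ i))) = multiEval T c a := by
    intro σ
    rw [multiEval, Finsupp.sum_of_support_subset c hc (fun v r => r • T fun i => a (v i))
      (fun _ _ => zero_smul _ _)]
    refine Finset.sum_bij' (fun w _ i => w (σ i)) (fun w _ i => w (σ⁻¹ i))
      (fun w hw => hX w hw σ) (fun w hw => hX w hw σ⁻¹) ?_ ?_ ?_
    · intro w _; simp
    · intro w _; simp
    · intro w _; rfl
  rw [Finset.sum_comm, Finset.sum_congr rfl (fun σ _ => key σ), Finset.sum_const,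
    Finset.card_univ, Fintype.card_perm, Fintype.card_fin, Nat.cast_smul_eq_nsmul]

theorem exists_perm_closed_superset (X : Finset (Fin n → ℕ)) : ∃ Y : Finset (Fin n → ℕ), X ⊆ Y ∧
    ∀ w ∈ Y, ∀ σ : Equiv.Perm (Fin n), (fun i => w (σ i)) ∈ Y := by
  refine ⟨Finset.univ.biUnion fun σ : Equiv.Perm (Fin n) => X.image fun w i => w (σ i), ?_, ?_⟩
  · intro w hw
    exact Finset.mem_biUnion.2 ⟨1, Finset.mem_univ _, Finset.mem_image.2 ⟨w, hw, rfl⟩⟩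
  · intro w hw σ
    obtain ⟨τ, -, hτ⟩ := Finset.mem_biUnion.1 hw
    obtain ⟨x, hx, rfl⟩ := Finset.mem_image.1 hτ
    exact Finset.mem_biUnion.2 ⟨τ * σ, Finset.mem_univ _, Finset.mem_image.2 ⟨x, hx, rfl⟩⟩

theorem multiEval_zero (T : MultilinearMap K (fun _ : Fin n => V) W) (a : ℕ → V) :
    multiEval T 0 a = 0 := Finsupp.sum_zero_index

theorem multiEval_add (T : MultilinearMap K (fun _ : Fin n => V) W) (c d : (Fin n → ℕ) →₀ K)
    (a : ℕ → V) : multiEval T (c + d) a = multiEval T c a + multiEval T d a :=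
  Finsupp.sum_add_index' (fun _ => zero_smul _ _) (fun _ _ _ => add_smul _ _ _)

theorem multiEval_single (T : MultilinearMap K (fun _ : Fin n => V) W) (v : Fin n → ℕ) (r : K)
    (a : ℕ → V) : multiEval T (Finsupp.single v r) a = r • T fun i => a (v i) :=
  Finsupp.sum_single_index (zero_smul _ _)

end Polarization

/-! ### The monomial shapes of degree at most 4 -/

section Monomials

variable (K : Type u) [Field K] (A : Type v) [NonUnitalNonAssocRing A] [Module K A]
  [IsScalarTower K A A] [SMulCommClass K A A]

/-- The monomial `x₀`. -/
def mon₁ : MultilinearMap K (fun _ : Fin 1 => A) A :=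
  MultilinearMap.mk' (fun x => x 0)
    (fun x i a b => by fin_cases i; simp)
    (fun x i r a => by fin_cases i; simp)

/-- The monomial `[x₀, x₁]`. -/
def mon₂ : MultilinearMap K (fun _ : Fin 2 => A) A :=
  MultilinearMap.mk' (fun x => x 0 * x 1)
    (fun x i a b => by fin_cases i <;> simp [mul_add, add_mul])
    (fun x i r a => by fin_cases i <;> simp [smul_mul_assoc, mul_smul_comm])

theorem mon₂_apply (x : Fin 2 → A) : mon₂ K A x = x 0 * x 1 := rfl

/-- The monomial `[[x₀, x₁], x₂]`. -/
def mon₃ : MultilinearMap K (fun _ : Fin 3 => A) A :=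
  MultilinearMap.mk' (fun x => x 0 * x 1 * x 2)
    (fun x i a b => by fin_cases i <;> simp [mul_add, add_mul])
    (fun x i r a => by fin_cases i <;> simp [smul_mul_assoc, mul_smul_comm])

theorem mon₃_apply (x : Fin 3 → A) : mon₃ K A x = x 0 * x 1 * x 2 := rfl

/-- The monomial `[[[x₀, x₁], x₂], x₃]`. -/
def mon₄ : MultilinearMap K (fun _ : Fin 4 => A) A :=
  MultilinearMap.mk' (fun x => x 0 * x 1 * x 2 * x 3)
    (fun x i a b => by fin_cases i <;> simp [mul_add, add_mul])
    (fun x i r a => by fin_cases i <;> simp [smul_mul_assoc, mul_smul_comm])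

theorem mon₄_apply (x : Fin 4 → A) : mon₄ K A x = x 0 * x 1 * x 2 * x 3 := rfl

/-- The monomial `[[x₀, x₁], [x₂, x₃]]`. -/
def mon₂₂ : MultilinearMap K (fun _ : Fin 4 => A) A :=
  MultilinearMap.mk' (fun x => x 0 * x 1 * (x 2 * x 3))
    (fun x i a b => by fin_cases i <;> simp [mul_add, add_mul])
    (fun x i r a => by fin_cases i <;> simp [smul_mul_assoc, mul_smul_comm])

theorem mon₂₂_apply (x : Fin 4 → A) : mon₂₂ K A x = x 0 * x 1 * (x 2 * x 3) := rfl

end Monomials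

/-! ### Normal forms modulo anticommutativity -/

section NormalForm

variable {K : Type u} [Field K]

/-- `f` is modulo anticommutativity a linear combination of the monomials `x`, `[x, y]`,
`[[x, y], z]`, `[[[x, y], z], t]` and `[[x, y], [z, t]]`. -/
def HasNormalForm (f : Poly K) : Prop :=
  ∃ (c₁ : (Fin 1 → ℕ) →₀ K) (c₂ : (Fin 2 → ℕ) →₀ K) (c₃ : (Fin 3 → ℕ) →₀ K)
    (c₄ d₄ : (Fin 4 → ℕ) →₀ K), ∀ (A : Type u) [NonUnitalNonAssocRing A] [Module K A]
      [IsScalarTower K A A] [SMulCommClass K A A], IsAnticommutative A → ∀ a : ℕ → A,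
      FreeNonUnitalNonAssocAlgebra.lift K a f = multiEval (mon₁ K A) c₁ a +
        multiEval (mon₂ K A) c₂ a + multiEval (mon₃ K A) c₃ a +
        (multiEval (mon₄ K A) c₄ a + multiEval (mon₂₂ K A) d₄ a)

theorem HasNormalForm.zero : HasNormalForm (0 : Poly K) :=
  ⟨0, 0, 0, 0, 0, fun A _ _ _ _ _ a => by simp [multiEval_zero]⟩

theorem HasNormalForm.add {f g : Poly K} (hf : HasNormalForm f) (hg : HasNormalForm g) :
    HasNormalForm (f + g) := by
  obtain ⟨c₁, c₂, c₃, c₄, d₄, h⟩ := hf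
  obtain ⟨c₁', c₂', c₃', c₄', d₄', h'⟩ := hg
  refine ⟨c₁ + c₁', c₂ + c₂', c₃ + c₃', c₄ + c₄', d₄ + d₄', fun A _ _ _ _ hA a => ?_⟩
  rw [map_add, h A hA, h' A hA]
  simp only [multiEval_add]
  abel

theorem lift_single {A : Type v} [NonUnitalNonAssocRing A] [Module K A]
    [IsScalarTower K A A] [SMulCommClass K A A] (a : ℕ → A) (m : FreeMagma ℕ) (r : K) :
    FreeNonUnitalNonAssocAlgebra.lift K a (MonoidAlgebra.single m r) =
      r • FreeMagma.lift a m := by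
  simp [FreeNonUnitalNonAssocAlgebra.lift, MonoidAlgebra.liftMagma]

theorem exists_eq_of_length_eq_one : ∀ m : FreeMagma ℕ, m.length = 1 → ∃ i, m = .of i
  | .of i, _ => ⟨i, rfl⟩
  | .mul x y, h => by
    have h : x.length + y.length = 1 := h
    have := x.length_pos
    have := y.length_pos
    omega

theorem exists_eq_of_length_eq_two :
    ∀ m : FreeMagma ℕ, m.length = 2 → ∃ i j, m = .of i * .of j
  | .mul x y, h => by
    have h : x.length + y.length = 2 := h
    have := x.length_pos
    have := y.length_pos
    obtain ⟨i, rfl⟩ := exists_eq_of_length_eq_one x (by omega)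
    obtain ⟨j, rfl⟩ := exists_eq_of_length_eq_one y (by omega)
    exact ⟨i, j, rfl⟩

theorem exists_eq_of_length_eq_three : ∀ m : FreeMagma ℕ, m.length = 3 →
    ∃ i j k, m = .of i * .of j * .of k ∨ m = .of k * (.of i * .of j)
  | .mul x y, h => by
    have h : x.length + y.length = 3 := h
    have := x.length_pos
    have := y.length_pos
    obtain hx | hx : x.length = 1 ∨ x.length = 2 := by omega
    · obtain ⟨k, rfl⟩ := exists_eq_of_length_eq_one x hx
      obtain ⟨i, j, rfl⟩ := exists_eq_of_length_eq_two y (by omega)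
      exact ⟨i, j, k, Or.inr rfl⟩
    · obtain ⟨i, j, rfl⟩ := exists_eq_of_length_eq_two x hx
      obtain ⟨k, rfl⟩ := exists_eq_of_length_eq_one y (by omega)
      exact ⟨i, j, k, Or.inl rfl⟩

theorem exists_eq_of_length_eq_four : ∀ m : FreeMagma ℕ, m.length = 4 → ∃ i j k l,
    m = .of i * .of j * .of k * .of l ∨ m = .of k * (.of i * .of j) * .of l ∨
    m = .of l * (.of i * .of j * .of k) ∨ m = .of l * (.of k * (.of i * .of j)) ∨
    m = .of i * .of j * (.of k * .of l)
  | .mul x y, h => by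
    have h : x.length + y.length = 4 := h
    have := x.length_pos
    have := y.length_pos
    obtain hx | hx | hx : x.length = 1 ∨ x.length = 2 ∨ x.length = 3 := by omega
    · obtain ⟨l, rfl⟩ := exists_eq_of_length_eq_one x hx
      obtain ⟨i, j, k, rfl | rfl⟩ := exists_eq_of_length_eq_three y (by omega)
      · exact ⟨i, j, k, l, Or.inr (Or.inr (Or.inl rfl))⟩
      · exact ⟨i, j, k, l, Or.inr (Or.inr (Or.inr (Or.inl rfl)))⟩
    · obtain ⟨i, j, rfl⟩ := exists_eq_of_length_eq_two x hx
      obtain ⟨k, l, rfl⟩ := exists_eq_of_length_eq_two y (by omega)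
      exact ⟨i, j, k, l, Or.inr (Or.inr (Or.inr (Or.inr rfl)))⟩
    · obtain ⟨l, rfl⟩ := exists_eq_of_length_eq_one y (by omega)
      obtain ⟨i, j, k, rfl | rfl⟩ := exists_eq_of_length_eq_three x hx
      · exact ⟨i, j, k, l, Or.inl rfl⟩
      · exact ⟨i, j, k, l, Or.inr (Or.inl rfl)⟩

/-- Each flip of a product into left-normed shape costs a sign, so one flip turns the coefficient
into `-r` and two flips restore `r`. -/
theorem hasNormalForm_single (m : FreeMagma ℕ) (hm : m.length ≤ 4) (r : K) :
    HasNormalForm (MonoidAlgebra.single m r : Poly K) := by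
  have := m.length_pos
  obtain h | h | h | h : m.length = 1 ∨ m.length = 2 ∨ m.length = 3 ∨ m.length = 4 := by omega
  · obtain ⟨i, rfl⟩ := exists_eq_of_length_eq_one m h
    refine ⟨Finsupp.single ![i] r, 0, 0, 0, 0, fun A _ _ _ _ hA a => ?_⟩
    simp only [lift_single, FreeMagma.lift_of]
    simp [multiEval_zero, multiEval_single, mon₁, -Finsupp.single_neg]
  · obtain ⟨i, j, rfl⟩ := exists_eq_of_length_eq_two m h
    refine ⟨0, Finsupp.single ![i, j] r, 0, 0, 0, fun A _ _ _ _ hA a => ?_⟩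
    simp only [lift_single, map_mul, FreeMagma.lift_of]
    simp [multiEval_zero, multiEval_single, mon₂_apply, -Finsupp.single_neg]
  · obtain ⟨i, j, k, rfl | rfl⟩ := exists_eq_of_length_eq_three m h
    · refine ⟨0, 0, Finsupp.single ![i, j, k] r, 0, 0, fun A _ _ _ _ hA a => ?_⟩
      simp only [lift_single, map_mul, FreeMagma.lift_of]
      simp [multiEval_zero, multiEval_single, mon₃_apply, -Finsupp.single_neg]
    · refine ⟨0, 0, Finsupp.single ![i, j, k] (-r), 0, 0, fun A _ _ _ _ hA a => ?_⟩
      simp only [lift_single, map_mul, FreeMagma.lift_of]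
      rw [hA.mul_comm_neg (a k)]
      simp [multiEval_zero, multiEval_single, mon₃_apply, -Finsupp.single_neg]
  · obtain ⟨i, j, k, l, rfl | rfl | rfl | rfl | rfl⟩ := exists_eq_of_length_eq_four m h
    · refine ⟨0, 0, 0, Finsupp.single ![i, j, k, l] r, 0, fun A _ _ _ _ hA a => ?_⟩
      simp only [lift_single, map_mul, FreeMagma.lift_of]
      simp [multiEval_zero, multiEval_single, mon₄_apply, -Finsupp.single_neg]
    · refine ⟨0, 0, 0, Finsupp.single ![i, j, k, l] (-r), 0, fun A _ _ _ _ hA a => ?_⟩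
      simp only [lift_single, map_mul, FreeMagma.lift_of]
      rw [hA.mul_comm_neg (a k)]
      simp [multiEval_zero, multiEval_single, mon₄_apply, -Finsupp.single_neg]
    · refine ⟨0, 0, 0, Finsupp.single ![i, j, k, l] (-r), 0, fun A _ _ _ _ hA a => ?_⟩
      simp only [lift_single, map_mul, FreeMagma.lift_of]
      rw [hA.mul_comm_neg (a l)]
      simp [multiEval_zero, multiEval_single, mon₄_apply, -Finsupp.single_neg]
    · refine ⟨0, 0, 0, Finsupp.single ![i, j, k, l] r, 0, fun A _ _ _ _ hA a => ?_⟩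
      simp only [lift_single, map_mul, FreeMagma.lift_of]
      rw [hA.mul_comm_neg (a l), hA.mul_comm_neg (a k)]
      simp [multiEval_zero, multiEval_single, mon₄_apply, -Finsupp.single_neg]
    · refine ⟨0, 0, 0, 0, Finsupp.single ![i, j, k, l] r, fun A _ _ _ _ hA a => ?_⟩
      simp only [lift_single, map_mul, FreeMagma.lift_of]
      simp [multiEval_zero, multiEval_single, mon₂₂_apply, -Finsupp.single_neg]

theorem hasNormalForm_of_degree_le {f : Poly K} (hf : degree f ≤ 4) : HasNormalForm f := by
  have h : f = ∑ m ∈ f.coeff.support, MonoidAlgebra.single m (f.coeff m) :=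
    f.sum_coeff_single.symm
  rw [h]
  refine Finset.sum_induction _ _ (fun _ _ => HasNormalForm.add) .zero fun m hm =>
    hasNormalForm_single m ((Finset.le_sup hm).trans hf) _

end NormalForm

/-! ### Explicit sums over small symmetric groups -/

theorem sum_perm_fin_succ {M : Type*} [AddCommMonoid M] {n : ℕ}
    (F : Equiv.Perm (Fin (n + 1)) → M) :
    ∑ σ, F σ = ∑ p : Fin (n + 1), ∑ e : Equiv.Perm (Fin n),
      F (Equiv.Perm.decomposeFin.symm (p, e)) := by
  rw [← Fintype.sum_prod_type' (f := fun p e => F (Equiv.Perm.decomposeFin.symm (p, e)))]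
  exact (Equiv.sum_comp Equiv.Perm.decomposeFin.symm F).symm

theorem sum_perm_fin_two {M : Type*} [AddCommMonoid M] (F : Fin 2 → Fin 2 → M) :
    ∑ σ : Equiv.Perm (Fin 2), F (σ 0) (σ 1) = F 0 1 + F 1 0 := by
  rw [sum_perm_fin_succ, Fin.sum_univ_two, Fintype.sum_unique, Fintype.sum_unique]
  rfl

theorem sum_perm_fin_three {M : Type*} [AddCommMonoid M] (F : Fin 3 → Fin 3 → Fin 3 → M) :
    ∑ σ : Equiv.Perm (Fin 3), F (σ 0) (σ 1) (σ 2) =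
      F 0 1 2 + F 0 2 1 + (F 1 0 2 + F 1 2 0) + (F 2 1 0 + F 2 0 1) := by
  rw [sum_perm_fin_succ, Fin.sum_univ_three]
  -- The permutation decomposed as (p, e) sends 0 to p and `i.succ` to the image of `(e i).succ`
  -- under the transposition of 0 and p; evaluating these swaps gives the listed order by
  -- definitional reduction.
  exact congrArg₂ _ (congrArg₂ _
    (sum_perm_fin_two fun i j => F 0 (Equiv.swap 0 0 i.succ) (Equiv.swap 0 0 j.succ))
    (sum_perm_fin_two fun i j => F 1 (Equiv.swap 0 1 i.succ) (Equiv.swap 0 1 j.succ)))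
    (sum_perm_fin_two fun i j => F 2 (Equiv.swap 0 2 i.succ) (Equiv.swap 0 2 j.succ))

theorem sum_perm_fin_four {M : Type*} [AddCommMonoid M] (F : Fin 4 → Fin 4 → Fin 4 → Fin 4 → M) :
    ∑ σ : Equiv.Perm (Fin 4), F (σ 0) (σ 1) (σ 2) (σ 3) =
      F 0 1 2 3 + F 0 1 3 2 + (F 0 2 1 3 + F 0 2 3 1) + (F 0 3 2 1 + F 0 3 1 2) +
      (F 1 0 2 3 + F 1 0 3 2 + (F 1 2 0 3 + F 1 2 3 0) + (F 1 3 2 0 + F 1 3 0 2)) +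
      (F 2 1 0 3 + F 2 1 3 0 + (F 2 0 1 3 + F 2 0 3 1) + (F 2 3 0 1 + F 2 3 1 0)) +
      (F 3 1 2 0 + F 3 1 0 2 + (F 3 2 1 0 + F 3 2 0 1) + (F 3 0 2 1 + F 3 0 1 2)) := by
  rw [sum_perm_fin_succ, Fin.sum_univ_four]
  exact congrArg₂ _ (congrArg₂ _ (congrArg₂ _
    (sum_perm_fin_three fun i j k =>
      F 0 (Equiv.swap 0 0 i.succ) (Equiv.swap 0 0 j.succ) (Equiv.swap 0 0 k.succ))
    (sum_perm_fin_three fun i j k =>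
      F 1 (Equiv.swap 0 1 i.succ) (Equiv.swap 0 1 j.succ) (Equiv.swap 0 1 k.succ)))
    (sum_perm_fin_three fun i j k =>
      F 2 (Equiv.swap 0 2 i.succ) (Equiv.swap 0 2 j.succ) (Equiv.swap 0 2 k.succ)))
    (sum_perm_fin_three fun i j k =>
      F 3 (Equiv.swap 0 3 i.succ) (Equiv.swap 0 3 j.succ) (Equiv.swap 0 3 k.succ))

/-! ### Independence of the quartic monomials on the cyclic algebra -/

section Quartic

variable {K : Type u} [Field K]

/-- Collects the 48 terms onto 12 left-normed monomials and 3 products of commutators, which span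
the multilinear part of degree 4 under anticommutativity. -/
theorem IsAnticommutative.sum_perm_quartic {A : Type v} [NonUnitalNonAssocRing A] [Module K A]
    (hA : IsAnticommutative A)
    (c d : Fin 4 → Fin 4 → Fin 4 → Fin 4 → K) (y : Fin 4 → A) :
    ∑ σ : Equiv.Perm (Fin 4), (c (σ 0) (σ 1) (σ 2) (σ 3) •
        (y (σ 0) * y (σ 1) * y (σ 2) * y (σ 3)) +
      d (σ 0) (σ 1) (σ 2) (σ 3) • (y (σ 0) * y (σ 1) * (y (σ 2) * y (σ 3)))) =
      (c 0 1 2 3 - c 1 0 2 3) • (y 0 * y 1 * y 2 * y 3) +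
      (c 0 1 3 2 - c 1 0 3 2) • (y 0 * y 1 * y 3 * y 2) +
      (c 0 2 1 3 - c 2 0 1 3) • (y 0 * y 2 * y 1 * y 3) +
      (c 0 2 3 1 - c 2 0 3 1) • (y 0 * y 2 * y 3 * y 1) +
      (c 0 3 1 2 - c 3 0 1 2) • (y 0 * y 3 * y 1 * y 2) +
      (c 0 3 2 1 - c 3 0 2 1) • (y 0 * y 3 * y 2 * y 1) +
      (c 1 2 0 3 - c 2 1 0 3) • (y 1 * y 2 * y 0 * y 3) +
      (c 1 2 3 0 - c 2 1 3 0) • (y 1 * y 2 * y 3 * y 0) +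
      (c 1 3 0 2 - c 3 1 0 2) • (y 1 * y 3 * y 0 * y 2) +
      (c 1 3 2 0 - c 3 1 2 0) • (y 1 * y 3 * y 2 * y 0) +
      (c 2 3 0 1 - c 3 2 0 1) • (y 2 * y 3 * y 0 * y 1) +
      (c 2 3 1 0 - c 3 2 1 0) • (y 2 * y 3 * y 1 * y 0) +
      (d 0 1 2 3 - d 1 0 2 3 - d 0 1 3 2 + d 1 0 3 2 -
        (d 2 3 0 1 - d 3 2 0 1 - d 2 3 1 0 + d 3 2 1 0)) • (y 0 * y 1 * (y 2 * y 3)) +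
      (d 0 2 1 3 - d 2 0 1 3 - d 0 2 3 1 + d 2 0 3 1 -
        (d 1 3 0 2 - d 3 1 0 2 - d 1 3 2 0 + d 3 1 2 0)) • (y 0 * y 2 * (y 1 * y 3)) +
      (d 0 3 1 2 - d 3 0 1 2 - d 0 3 2 1 + d 3 0 2 1 -
        (d 1 2 0 3 - d 2 1 0 3 - d 1 2 3 0 + d 2 1 3 0)) • (y 0 * y 3 * (y 1 * y 2)) := by
  rw [sum_perm_fin_four fun i j k l => c i j k l • (y i * y j * y k * y l) +
    d i j k l • (y i * y j * (y k * y l))]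
  simp only [hA.mul_comm_neg (y 1) (y 0), hA.mul_comm_neg (y 2) (y 0),
    hA.mul_comm_neg (y 3) (y 0), hA.mul_comm_neg (y 2) (y 1), hA.mul_comm_neg (y 3) (y 1),
    hA.mul_comm_neg (y 3) (y 2), hA.mul_comm_neg (y 2 * y 3) (y 0 * y 1),
    hA.mul_comm_neg (y 1 * y 3) (y 0 * y 2), hA.mul_comm_neg (y 1 * y 2) (y 0 * y 3),
    neg_mul, mul_neg, neg_neg, smul_neg]
  module

/-- The six evaluations on `e₀`, `e₁`, `e₂` with one repetition kill the d's and leave only the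
multiples of the alternating sum of [[[x, y], z], t]. That sum vanishes on any three-dimensional
span, which is why the fourth basis vector is needed. -/
theorem cyclicAlg_quartic_independent (h2 : (2 : K) ≠ 0) (h3 : (3 : K) ≠ 0)
    {c0123 c0132 c0213 c0231 c0312 c0321 c1203 c1230 c1302 c1320 c2301 c2310
      d0123 d0213 d0312 : K}
    (h : ∀ y : Fin 4 → CyclicAlg K,
      c0123 • (y 0 * y 1 * y 2 * y 3) +
      c0132 • (y 0 * y 1 * y 3 * y 2) +
      c0213 • (y 0 * y 2 * y 1 * y 3) +
      c0231 • (y 0 * y 2 * y 3 * y 1) +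
      c0312 • (y 0 * y 3 * y 1 * y 2) +
      c0321 • (y 0 * y 3 * y 2 * y 1) +
      c1203 • (y 1 * y 2 * y 0 * y 3) +
      c1230 • (y 1 * y 2 * y 3 * y 0) +
      c1302 • (y 1 * y 3 * y 0 * y 2) +
      c1320 • (y 1 * y 3 * y 2 * y 0) +
      c2301 • (y 2 * y 3 * y 0 * y 1) +
      c2310 • (y 2 * y 3 * y 1 * y 0) +
      d0123 • (y 0 * y 1 * (y 2 * y 3)) +
      d0213 • (y 0 * y 2 * (y 1 * y 3)) +
      d0312 • (y 0 * y 3 * (y 1 * y 2)) = 0) :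
    c0123 = 0 ∧ c0132 = 0 ∧ c0213 = 0 ∧ c0231 = 0 ∧ c0312 = 0 ∧ c0321 = 0 ∧
    c1203 = 0 ∧ c1230 = 0 ∧ c1302 = 0 ∧ c1320 = 0 ∧ c2301 = 0 ∧ c2310 = 0 ∧
    d0123 = 0 ∧ d0213 = 0 ∧ d0312 = 0 := by
  obtain ⟨p0, q0, s0, -⟩ := cyclicAlg_linearIndependent
    (a := -c0321 - c1320) (b := c0312 + c1302)
    (c := -c0231 - c1230 + d0213 - d0312)
    (d := 0)
    (by
      refine Eq.trans ?_ (h ![e₀ K, e₀ K, e₁ K, e₂ K])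
      simp
      module)
  obtain ⟨p1, q1, -, -⟩ := cyclicAlg_linearIndependent
    (a := -c0231 - c1230) (b := c0213 + c1203)
    (c := -c0321 - c1320 - d0213 + d0312)
    (d := 0)
    (by
      refine Eq.trans ?_ (h ![e₀ K, e₀ K, e₂ K, e₁ K])
      simp
      module)
  obtain ⟨p2, q2, s2, -⟩ := cyclicAlg_linearIndependent
    (a := -c0312 - c2310) (b := c0321 + c2301)
    (c := -c0132 + c1230 + d0123 + d0312)
    (d := 0)
    (by
      refine Eq.trans ?_ (h ![e₀ K, e₁ K, e₀ K, e₂ K])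
      simp
      module)
  obtain ⟨-, q3, s3, -⟩ := cyclicAlg_linearIndependent
    (a := -c1302 - c2301 + d0123 + d0213) (b := c0132 + c0231)
    (c := -c0123 - c0213)
    (d := 0)
    (by
      refine Eq.trans ?_ (h ![e₀ K, e₁ K, e₁ K, e₂ K])
      simp
      module)
  obtain ⟨-, q4, s4, -⟩ := cyclicAlg_linearIndependent
    (a := -c1203 + c2301 - d0123 + d0312) (b := c0123 + c0321)
    (c := -c0132 - c0312)
    (d := 0)
    (by
      refine Eq.trans ?_ (h ![e₀ K, e₁ K, e₂ K, e₁ K])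
      simp
      module)
  obtain ⟨p5, q5, -, -⟩ := cyclicAlg_linearIndependent
    (a := c1203 + c1302 - d0213 - d0312) (b := c0213 + c0312)
    (c := -c0231 - c0321)
    (d := 0)
    (by
      refine Eq.trans ?_ (h ![e₀ K, e₂ K, e₁ K, e₁ K])
      simp
      module)
  -- On four distinct basis vectors the remaining alternating relation takes the value 6 • c0123 •
  -- e₃.
  obtain ⟨-, -, -, t6⟩ := cyclicAlg_linearIndependent
    (a := 0) (b := 0)
    (c := 0)
    (d := c0123 - c0132 - c0213 + c0231 - c0312 - c0321 + c1203 - c1230 - c1302 -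
      c1320 - c2301 - c2310 + d0123 - d0213 - d0312)
    (by
      refine Eq.trans ?_ (h ![e₀ K, e₁ K, e₂ K, e₃ K])
      simp
      module)
  have e0213 : c0213 = -c0123 := by linear_combination -s3
  have e0321 : c0321 = -c0123 := by linear_combination q4
  have e0312 : c0312 = c0123 := by linear_combination q5 - e0213
  have e0132 : c0132 = -c0123 := by linear_combination -s4 - e0312
  have e0231 : c0231 = c0123 := by linear_combination q3 - e0132
  have e1203 : c1203 = c0123 := by linear_combination q1 - e0213
  have e1230 : c1230 = -c0123 := by linear_combination -p1 - e0231
  have e1302 : c1302 = -c0123 := by linear_combination q0 - e0312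
  have e1320 : c1320 = c0123 := by linear_combination -p0 - e0321
  have e2301 : c2301 = c0123 := by linear_combination q2 - e0321
  have e2310 : c2310 = -c0123 := by linear_combination -p2 - e0312
  have f0213 : d0213 = 0 := mul_left_cancel₀ h2 (by
    linear_combination s0 + e0231 + e1230 - p5 + e1203 + e1302)
  have f0312 : d0312 = 0 := by linear_combination f0213 - s0 - e0231 - e1230
  have f0123 : d0123 = 0 := by linear_combination s2 - f0312 + e0132 - e1230
  have e0123 : c0123 = 0 := mul_left_cancel₀ (mul_ne_zero h2 h3) (by
    linear_combination t6 + e0132 + e0213 - e0231 + e0312 + e0321 - e1203 + e1230 + e1302 +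
      e1320 + e2301 + e2310 - f0123 + f0213 + f0312)
  simp_all

end Quartic

/-! ### Passing between identities and their polarizations -/

section Polarization

variable {K : Type u} [Field K] {V W : Type*} [AddCommGroup V] [Module K V]
  [AddCommGroup W] [Module K W] {n : ℕ} {T T' : MultilinearMap K (fun _ : Fin n => V) W}
  {c c' : (Fin n → ℕ) →₀ K}

/-- Two multilinear maps are carried along because degree 4 has two monomial shapes; lower degrees
take `c' = 0`. -/
theorem polarization_eq_zero (h : ∀ a : ℕ → V, multiEval T c a + multiEval T' c' a = 0)
    (w : Fin n → ℕ) (y : Fin n → V) : ∑ σ : Equiv.Perm (Fin n),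
      (c (fun i => w (σ i)) • T (fun i => y (σ i)) +
        c' (fun i => w (σ i)) • T' (fun i => y (σ i))) = 0 := by
  rw [Finset.sum_add_distrib, ← sum_neg_one_pow_multiEval, ← sum_neg_one_pow_multiEval,
    ← Finset.sum_add_distrib]
  refine Finset.sum_eq_zero fun S _ => ?_
  rw [← smul_add, h, smul_zero]

theorem multiEval_eq_zero_of_polarization (hn : (n.factorial : K) ≠ 0) {a : ℕ → V}
    (h : ∀ w : Fin n → ℕ, ∑ σ : Equiv.Perm (Fin n),
      (c (fun i => w (σ i)) • T (fun i => a (w (σ i))) +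
        c' (fun i => w (σ i)) • T' (fun i => a (w (σ i)))) = 0) :
    multiEval T c a + multiEval T' c' a = 0 := by
  obtain ⟨X, hX, hσ⟩ := exists_perm_closed_superset (c.support ∪ c'.support)
  have : (n.factorial : K) • (multiEval T c a + multiEval T' c' a) = 0 := by
    rw [smul_add, factorial_smul_multiEval T c (Finset.union_subset_left hX) hσ,
      factorial_smul_multiEval T' c' (Finset.union_subset_right hX) hσ,
      ← Finset.sum_add_distrib]
    refine Finset.sum_eq_zero fun w _ => ?_
    rw [← Finset.sum_add_distrib, h]
  exact (smul_eq_zero.1 this).resolve_left hn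

end Polarization

/-! ### No nontrivial identities of degree at most 4 -/

section LowDegree

variable {K : Type u} [Field K] {A : Type v} [NonUnitalNonAssocRing A] [Module K A]

theorem quartic_polarization_eq_zero (h2 : (2 : K) ≠ 0) (h3 : (3 : K) ≠ 0)
    {c d : Fin 4 → Fin 4 → Fin 4 → Fin 4 → K}
    (h : ∀ y : Fin 4 → CyclicAlg K, ∑ σ : Equiv.Perm (Fin 4), (c (σ 0) (σ 1) (σ 2) (σ 3) •
        (y (σ 0) * y (σ 1) * y (σ 2) * y (σ 3)) +
      d (σ 0) (σ 1) (σ 2) (σ 3) • (y (σ 0) * y (σ 1) * (y (σ 2) * y (σ 3)))) = 0)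
    (hA : IsAnticommutative A) (y : Fin 4 → A) :
    ∑ σ : Equiv.Perm (Fin 4), (c (σ 0) (σ 1) (σ 2) (σ 3) •
        (y (σ 0) * y (σ 1) * y (σ 2) * y (σ 3)) +
      d (σ 0) (σ 1) (σ 2) (σ 3) • (y (σ 0) * y (σ 1) * (y (σ 2) * y (σ 3)))) = 0 := by
  have hL := fun y => (IsAnticommutative.sum_perm_quartic
    (isOmegaLieAlgebra_cyclicAlg K).anticommutative c d y).symm.trans (h y)
  obtain ⟨r₁, r₂, r₃, r₄, r₅, r₆, r₇, r₈, r₉, r₁₀, r₁₁, r₁₂, s₁, s₂, s₃⟩ :=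
    cyclicAlg_quartic_independent h2 h3 hL
  rw [hA.sum_perm_quartic, r₁, r₂, r₃, r₄, r₅, r₆, r₇, r₈, r₉, r₁₀, r₁₁, r₁₂, s₁, s₂, s₃]
  simp only [zero_smul, add_zero]

theorem IsAnticommutative.sum_perm_cubic (hA : IsAnticommutative A)
    (c : Fin 3 → Fin 3 → Fin 3 → K) (y : Fin 3 → A) :
    ∑ σ : Equiv.Perm (Fin 3), c (σ 0) (σ 1) (σ 2) • (y (σ 0) * y (σ 1) * y (σ 2)) =
      (c 0 1 2 - c 1 0 2) • (y 0 * y 1 * y 2) + (c 0 2 1 - c 2 0 1) • (y 0 * y 2 * y 1) +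
      (c 1 2 0 - c 2 1 0) • (y 1 * y 2 * y 0) := by
  rw [sum_perm_fin_three fun i j k => c i j k • (y i * y j * y k)]
  simp only [hA.mul_comm_neg (y 1) (y 0), hA.mul_comm_neg (y 2) (y 0),
    hA.mul_comm_neg (y 2) (y 1), neg_mul, smul_neg]
  module

/-- If a combination of variables vanishes on the cyclic algebra, then it vanishes on all
algebras. -/
theorem linear_eq_zero {c : (Fin 1 → ℕ) →₀ K}
    (h : ∀ a : ℕ → CyclicAlg K, multiEval (mon₁ K (CyclicAlg K)) c a = 0) (a : ℕ → A) :
    multiEval (mon₁ K A) c a = 0 := by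
  have hc : c = 0 := by
    ext w
    have hL := polarization_eq_zero (T' := mon₁ K (CyclicAlg K)) (c' := 0)
      (fun a => by rw [h, multiEval_zero, add_zero]) w ![e₀ K]
    rw [Fintype.sum_unique, Finsupp.coe_zero, Pi.zero_apply, zero_smul, add_zero] at hL
    obtain ⟨r, -⟩ := cyclicAlg_linearIndependent (a := c w) (b := 0) (c := 0) (d := 0)
      (by
        rw [zero_smul, zero_smul, zero_smul, add_zero, add_zero, add_zero]
        exact hL)
    exact r
  rw [hc, multiEval_zero]

variable [IsScalarTower K A A] [SMulCommClass K A A]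

/-- If a combination of quartic monomials vanishes on the cyclic algebra, then it vanishes on all
anticommutative algebras. -/
theorem quartic_eq_zero (h2 : (2 : K) ≠ 0) (h3 : (3 : K) ≠ 0) {c d : (Fin 4 → ℕ) →₀ K}
    (h : ∀ a : ℕ → CyclicAlg K,
      multiEval (mon₄ K (CyclicAlg K)) c a + multiEval (mon₂₂ K (CyclicAlg K)) d a = 0)
    (hA : IsAnticommutative A) (a : ℕ → A) :
    multiEval (mon₄ K A) c a + multiEval (mon₂₂ K A) d a = 0 := by
  have h24 : ((Nat.factorial 4 : ℕ) : K) ≠ 0 := by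
    have : ((Nat.factorial 4 : ℕ) : K) = 2 * 2 * 2 * 3 := by
      norm_num [Nat.factorial]
    rw [this]
    simp [h2, h3]
  refine multiEval_eq_zero_of_polarization h24 fun w => ?_
  have hw : ∀ σ : Equiv.Perm (Fin 4),
      (fun i => w (σ i)) = ![w (σ 0), w (σ 1), w (σ 2), w (σ 3)] := by
    intro σ
    ext i
    fin_cases i <;> rfl
  have hL := polarization_eq_zero h w
  simp only [hw, mon₄_apply, mon₂₂_apply] at hL ⊢
  exact quartic_polarization_eq_zero h2 h3 (c := fun i j k l => c ![w i, w j, w k, w l])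
    (d := fun i j k l => d ![w i, w j, w k, w l]) hL hA fun i => a (w i)

/-- If a combination of cubic monomials vanishes on the cyclic algebra, then it vanishes on all
anticommutative algebras. -/
theorem cubic_eq_zero (h2 : (2 : K) ≠ 0) (h3 : (3 : K) ≠ 0) {c : (Fin 3 → ℕ) →₀ K}
    (h : ∀ a : ℕ → CyclicAlg K, multiEval (mon₃ K (CyclicAlg K)) c a = 0)
    (hA : IsAnticommutative A) (a : ℕ → A) : multiEval (mon₃ K A) c a = 0 := by
  have h6 : ((Nat.factorial 3 : ℕ) : K) ≠ 0 := by
    have : ((Nat.factorial 3 : ℕ) : K) = 2 * 3 := by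
      norm_num [Nat.factorial]
    rw [this]
    exact mul_ne_zero h2 h3
  rw [← add_zero (multiEval _ c a), ← multiEval_zero (mon₃ K A) a]
  refine multiEval_eq_zero_of_polarization h6 fun w => ?_
  have hw : ∀ σ : Equiv.Perm (Fin 3),
      (fun i => w (σ i)) = ![w (σ 0), w (σ 1), w (σ 2)] := by
    intro σ
    ext i
    fin_cases i <;> rfl
  have hL := polarization_eq_zero (T' := mon₃ K (CyclicAlg K)) (c' := 0)
    (fun a => by rw [h, multiEval_zero, add_zero]) w ![e₀ K, e₁ K, e₂ K]
  simp only [hw, mon₃_apply, Finsupp.coe_zero, Pi.zero_apply, zero_smul, add_zero] at hL ⊢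
  rw [IsAnticommutative.sum_perm_cubic (isOmegaLieAlgebra_cyclicAlg K).anticommutative
    (fun i j k => c ![w i, w j, w k])] at hL
  rw [hA.sum_perm_cubic (fun i j k => c ![w i, w j, w k]) (fun i => a (w i))]
  -- One substitution suffices: at `e₀`, `e₁`, `e₂` the three cubic monomials take the values -e₂,
  -- e₁ and -e₀.
  obtain ⟨r₁, r₂, r₃, -⟩ := cyclicAlg_linearIndependent
    (a := -(c ![w 1, w 2, w 0] - c ![w 2, w 1, w 0]))
    (b := c ![w 0, w 2, w 1] - c ![w 2, w 0, w 1])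
    (c := -(c ![w 0, w 1, w 2] - c ![w 1, w 0, w 2])) (d := 0)
    (by
      refine Eq.trans ?_ hL
      simp
      module)
  simp only [neg_eq_zero] at r₁ r₃
  simp only [r₁, r₂, r₃, zero_smul, add_zero]

/-- If a combination of quadratic monomials vanishes on the cyclic algebra, then it vanishes on all
anticommutative algebras. -/
theorem quadratic_eq_zero (h2 : (2 : K) ≠ 0) {c : (Fin 2 → ℕ) →₀ K}
    (h : ∀ a : ℕ → CyclicAlg K, multiEval (mon₂ K (CyclicAlg K)) c a = 0)
    (hA : IsAnticommutative A) (a : ℕ → A) : multiEval (mon₂ K A) c a = 0 := by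
  rw [← add_zero (multiEval _ c a), ← multiEval_zero (mon₂ K A) a]
  refine multiEval_eq_zero_of_polarization (by simpa [Nat.factorial] using h2) fun w => ?_
  have hw : ∀ σ : Equiv.Perm (Fin 2), (fun i => w (σ i)) = ![w (σ 0), w (σ 1)] := by
    intro σ
    ext i
    fin_cases i <;> rfl
  have hL := polarization_eq_zero (T' := mon₂ K (CyclicAlg K)) (c' := 0)
    (fun a => by rw [h, multiEval_zero, add_zero]) w ![e₀ K, e₁ K]
  simp only [hw, mon₂_apply, Finsupp.coe_zero, Pi.zero_apply, zero_smul, add_zero] at hL ⊢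
  rw [sum_perm_fin_two fun i j => c ![w i, w j] •
    ((![e₀ K, e₁ K] : Fin 2 → CyclicAlg K) i * (![e₀ K, e₁ K] : Fin 2 → CyclicAlg K) j)] at hL
  rw [sum_perm_fin_two fun i j => c ![w i, w j] • (a (w i) * a (w j)),
    hA.mul_comm_neg (a (w 1))]
  obtain ⟨r, -⟩ := cyclicAlg_linearIndependent
    (a := c ![w 0, w 1] - c ![w 1, w 0]) (b := 0) (c := 0) (d := 0)
    (by
      refine Eq.trans ?_ hL
      simp
      module)
  rw [sub_eq_zero.1 r, smul_neg, add_neg_cancel]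

/-- Every identity of degree at most `4` of the cyclic algebra is trivial. -/
theorem isTrivialIdentity_of_satisfies_cyclicAlg (h2 : (2 : K) ≠ 0) (h3 : (3 : K) ≠ 0)
    {f : Poly K} (hd : degree f ≤ 4) (hf : Satisfies (CyclicAlg K) f) : IsTrivialIdentity f := by
  obtain ⟨c₁, c₂, c₃, c₄, d₄, hN⟩ := hasNormalForm_of_degree_le hd
  set C := CyclicAlg K
  have hC : IsAnticommutative C := (isOmegaLieAlgebra_cyclicAlg K).anticommutative
  have key : ∀ (t : K) (a : ℕ → C), t • multiEval (mon₁ K C) c₁ a +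
      t ^ 2 • multiEval (mon₂ K C) c₂ a + t ^ 3 • multiEval (mon₃ K C) c₃ a +
      t ^ 4 • (multiEval (mon₄ K C) c₄ a + multiEval (mon₂₂ K C) d₄ a) = 0 := by
    intro t a
    have h := (hN C hC fun i => t • a i).symm.trans (hf _)
    simpa only [multiEval_smul, pow_one, smul_add] using h
  have h4 : ∀ a : ℕ → C, multiEval (mon₄ K C) c₄ a + multiEval (mon₂₂ K C) d₄ a = 0 := by
    intro a
    -- Adding the values at t and -t removes the odd degrees, and 2² - 4 · 1² = 0 removes degree 2;
    -- degree 4 is left with the factor 2(16 - 4) = 24.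
    have : (2 * 2 * 2 * 3 : K) •
        (multiEval (mon₄ K C) c₄ a + multiEval (mon₂₂ K C) d₄ a) = 0 := by
      linear_combination (norm := module)
        key 2 a + key (-2) a - (4 : K) • key 1 a - (4 : K) • key (-1) a
    exact (smul_eq_zero.1 this).resolve_left (by simp [h2, h3])
  have h3' : ∀ a : ℕ → C, multiEval (mon₃ K C) c₃ a = 0 := by
    intro a
    -- The odd part, with degree 1 removed by 2 - 2 · 1 = 0; degree 3 is left with the factor 2(8 -
    -- 2) = 12.
    have : (2 * 2 * 3 : K) • multiEval (mon₃ K C) c₃ a = 0 := by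
      linear_combination (norm := module)
        key 2 a - key (-2) a - (2 : K) • key 1 a + (2 : K) • key (-1) a
    exact (smul_eq_zero.1 this).resolve_left (by simp [h2, h3])
  have h2' : ∀ a : ℕ → C, multiEval (mon₂ K C) c₂ a = 0 := by
    intro a
    have : (2 : K) • multiEval (mon₂ K C) c₂ a = 0 := by
      linear_combination (norm := module) key 1 a + key (-1) a - (2 : K) • h4 a
    exact (smul_eq_zero.1 this).resolve_left h2
  have h1' : ∀ a : ℕ → C, multiEval (mon₁ K C) c₁ a = 0 := by
    intro a
    linear_combination (norm := module) key 1 a - h2' a - h3' a - h4 a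
  intro A _ _ _ _ hA a
  rw [hN A hA, linear_eq_zero h1', quadratic_eq_zero h2 h2' hA, cubic_eq_zero h2 h3 h3' hA,
    quartic_eq_zero h2 h3 h4 hA]
  simp only [add_zero]

end LowDegree

/-! ### Alternating sums over five letters -/

section AlternatingSum

variable {M : Type*} [AddCommGroup M]

/-- The alternating sum of `g` over the permutations of five letters. -/
def altSum (g : Fin 5 → Fin 5 → Fin 5 → Fin 5 → Fin 5 → M) : M :=
  ∑ σ : Equiv.Perm (Fin 5), (Equiv.Perm.sign σ : ℤ) • g (σ 0) (σ 1) (σ 2) (σ 3) (σ 4)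

/-- Right multiplication by an even τ permutes the group and preserves signs. It is applied below to
3-cycles, written as products of two transpositions. -/
theorem altSum_comp (g : Fin 5 → Fin 5 → Fin 5 → Fin 5 → Fin 5 → M) (τ : Equiv.Perm (Fin 5))
    (hτ : Equiv.Perm.sign τ = 1) :
    ∑ σ : Equiv.Perm (Fin 5), (Equiv.Perm.sign σ : ℤ) •
      g (σ (τ 0)) (σ (τ 1)) (σ (τ 2)) (σ (τ 3)) (σ (τ 4)) = altSum g := by
  refine Eq.trans (Finset.sum_congr rfl fun σ _ => ?_) (Equiv.sum_comp (Equiv.mulRight τ)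
    fun σ => (Equiv.Perm.sign σ : ℤ) • g (σ 0) (σ 1) (σ 2) (σ 3) (σ 4))
  simp [Equiv.Perm.sign_mul, hτ]

theorem altSum_rotate_first (g : Fin 5 → Fin 5 → Fin 5 → Fin 5 → Fin 5 → M) :
    altSum (fun i j k l m => g j k i l m) = altSum g := by
  have h := altSum_comp g (Equiv.swap 0 1 * Equiv.swap 1 2)
    (by rw [Equiv.Perm.sign_mul, Equiv.Perm.sign_swap (by decide),
      Equiv.Perm.sign_swap (by decide), Int.units_mul_self])
  simp only [Equiv.Perm.mul_apply, show Equiv.swap (1 : Fin 5) 2 0 = 0 by decide,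
    show Equiv.swap (1 : Fin 5) 2 1 = 2 by decide, show Equiv.swap (1 : Fin 5) 2 2 = 1 by decide,
    show Equiv.swap (1 : Fin 5) 2 3 = 3 by decide, show Equiv.swap (1 : Fin 5) 2 4 = 4 by decide,
    show Equiv.swap (0 : Fin 5) 1 0 = 1 by decide, show Equiv.swap (0 : Fin 5) 1 1 = 0 by decide,
    show Equiv.swap (0 : Fin 5) 1 2 = 2 by decide, show Equiv.swap (0 : Fin 5) 1 3 = 3 by decide,
    show Equiv.swap (0 : Fin 5) 1 4 = 4 by decide] at h
  exact h

theorem altSum_rotate_last (g : Fin 5 → Fin 5 → Fin 5 → Fin 5 → Fin 5 → M) :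
    altSum (fun i j k l m => g i j l m k) = altSum g := by
  have h := altSum_comp g (Equiv.swap 2 3 * Equiv.swap 3 4)
    (by rw [Equiv.Perm.sign_mul, Equiv.Perm.sign_swap (by decide),
      Equiv.Perm.sign_swap (by decide), Int.units_mul_self])
  simp only [Equiv.Perm.mul_apply, show Equiv.swap (3 : Fin 5) 4 0 = 0 by decide,
    show Equiv.swap (3 : Fin 5) 4 1 = 1 by decide, show Equiv.swap (3 : Fin 5) 4 2 = 2 by decide,
    show Equiv.swap (3 : Fin 5) 4 3 = 4 by decide, show Equiv.swap (3 : Fin 5) 4 4 = 3 by decide,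
    show Equiv.swap (2 : Fin 5) 3 0 = 0 by decide, show Equiv.swap (2 : Fin 5) 3 1 = 1 by decide,
    show Equiv.swap (2 : Fin 5) 3 2 = 3 by decide, show Equiv.swap (2 : Fin 5) 3 3 = 2 by decide,
    show Equiv.swap (2 : Fin 5) 3 4 = 4 by decide] at h
  exact h

theorem altSum_add (g h : Fin 5 → Fin 5 → Fin 5 → Fin 5 → Fin 5 → M) :
    altSum (fun i j k l m => g i j k l m + h i j k l m) = altSum g + altSum h := by
  simp only [altSum, smul_add, Finset.sum_add_distrib]

theorem altSum_neg (g : Fin 5 → Fin 5 → Fin 5 → Fin 5 → Fin 5 → M) :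
    altSum (fun i j k l m => -g i j k l m) = -altSum g := by
  simp only [altSum, smul_neg, Finset.sum_neg_distrib]

/-- The sum of `g` over the cyclic permutations of the first three letters. -/
theorem altSum_cyclic (g : Fin 5 → Fin 5 → Fin 5 → Fin 5 → Fin 5 → M) :
    altSum (fun i j k l m => g i j k l m + g k i j l m + g j k i l m) = 3 • altSum g := by
  have h₁ := altSum_rotate_first g
  have h₂ := altSum_rotate_first fun i j k l m => g k i j l m
  rw [altSum_add (fun i j k l m => g i j k l m + g k i j l m), altSum_add, h₁, ← h₂, succ_nsmul,
    two_nsmul]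

end AlternatingSum

/-! ### The quintic identity and its nontriviality -/

section Quintic

variable {K : Type u} [Field K]

theorem lift_quinticPoly {A : Type v} [NonUnitalNonAssocRing A] [Module K A]
    [IsScalarTower K A A] [SMulCommClass K A A] (a : ℕ → A) :
    FreeNonUnitalNonAssocAlgebra.lift K a (quinticPoly K) =
      altSum fun i j k l m => a i * a j * a k * a l * a m + a i * a j * a k * (a l * a m) := by
  simp only [quinticPoly, altSum, map_sum, map_zsmul, map_add, map_mul,
    FreeNonUnitalNonAssocAlgebra.lift_of_apply]

theorem holdsInOmegaLieAlgebras_quinticPoly (h3 : (3 : K) ≠ 0) :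
    HoldsInOmegaLieAlgebras.{u, v} (quinticPoly K) := by
  intro L _ _ _ _ hL a
  obtain ⟨ω, hω⟩ := hL.exists_form
  rw [lift_quinticPoly]
  set S : Fin 5 → Fin 5 → Fin 5 → Fin 5 → Fin 5 → L := fun i j k l m =>
    a i * a j * a k * a l * a m + a i * a j * a k * (a l * a m) with hS
  set U : Fin 5 → Fin 5 → Fin 5 → Fin 5 → Fin 5 → L := fun i j k l m =>
    ω (a i) (a j) • (a k * a l * a m) with hU
  have hrot : (fun i j k l m => S i j k l m + S k i j l m + S j k i l m) = fun i j k l m =>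
      (U i j k l m - U i j l m k) + (U k i j l m - U k i l m j) +
      (U j k i l m - U j k l m i) := by
    funext i j k l m
    have hJ := hω (a i) (a j) (a k)
    have h1 := congrArg (fun z => z * a l * a m + z * (a l * a m)) hJ
    -- Replacing z(lm) by -(lm)z gives both terms multiplying each value of ω the shape of `U`, with
    -- the last three letters rotated in one of them.
    have hc := fun z => hL.anticommutative.mul_comm_neg z (a l * a m)
    simp only [jacobian, add_mul, smul_mul_assoc, hc (a i), hc (a j), hc (a k)] at h1
    simp only [hS, hU]
    refine Eq.trans ?_ (h1.trans ?_)
    · abel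
    · module
  have h : (3 : K) • altSum S = 0 := by
    have h' := altSum_cyclic S
    rw [hrot, altSum_cyclic fun i j k l m => U i j k l m - U i j l m k] at h'
    have h0 : altSum (fun i j k l m => U i j k l m - U i j l m k) = 0 := by
      simp only [sub_eq_add_neg]
      rw [altSum_add U, altSum_neg fun i j k l m => U i j l m k, altSum_rotate_last U,
        add_neg_cancel]
    rw [h0, smul_zero] at h'
    rw [show (3 : K) = ((3 : ℕ) : K) by norm_num, Nat.cast_smul_eq_nsmul]
    exact h'.symm
  exact (smul_eq_zero.1 h).resolve_left h3

variable (K) in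
/-- The multiplication of the nine-dimensional nilpotent anticommutative algebra with
`e₀e₁ = e₅`, `e₅e₂ = e₆`, `e₆e₃ = e₇`, `e₇e₄ = e₈`. -/
def chainMul : (Fin 9 → K) →ₗ[K] (Fin 9 → K) →ₗ[K] (Fin 9 → K) :=
  LinearMap.mk₂ K (fun x y => ![0, 0, 0, 0, 0, x 0 * y 1 - x 1 * y 0, x 5 * y 2 - x 2 * y 5,
      x 6 * y 3 - x 3 * y 6, x 7 * y 4 - x 4 * y 7])
    (fun x x' y => by ext i; fin_cases i <;> simp <;> ring)
    (fun c x y => by ext i; fin_cases i <;> simp <;> ring)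
    (fun x y y' => by ext i; fin_cases i <;> simp <;> ring)
    (fun c x y => by ext i; fin_cases i <;> simp <;> ring)

theorem chainMul_apply (x y : Fin 9 → K) : chainMul K x y =
    ![0, 0, 0, 0, 0, x 0 * y 1 - x 1 * y 0, x 5 * y 2 - x 2 * y 5,
      x 6 * y 3 - x 3 * y 6, x 7 * y 4 - x 4 * y 7] := rfl

theorem chainMul_self (x : Fin 9 → K) : chainMul K x x = 0 := by
  rw [chainMul_apply]
  ext i
  fin_cases i <;> simp <;> ring

/-- The second word contributes nothing: [[x, y], z] is a multiple of e₆ and [t, s] a multiple of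
e₅, and these two multiply to 0. -/
theorem chainMul_word (x y z t s : Fin 9 → K) (hx : x 5 = 0 ∧ x 6 = 0 ∧ x 7 = 0)
    (hy : y 5 = 0 ∧ y 6 = 0 ∧ y 7 = 0) (hz : z 5 = 0 ∧ z 6 = 0 ∧ z 7 = 0)
    (ht : t 5 = 0 ∧ t 6 = 0 ∧ t 7 = 0) (hs : s 5 = 0 ∧ s 6 = 0 ∧ s 7 = 0) :
    (chainMul K (chainMul K (chainMul K (chainMul K x y) z) t) s +
      chainMul K (chainMul K (chainMul K x y) z) (chainMul K t s)) 8 =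
    (x 0 * y 1 - x 1 * y 0) * z 2 * t 3 * s 4 := by
  simp [chainMul_apply, hx, hy, hz, ht, hs]

/-- Only the identity and the transposition of 0 and 1 contribute, each +1, because the sign of the
transposition meets the minus sign of the flipped product. The total 2 is the e₈-coordinate of the
quintic, nonzero away from characteristic 2. -/
theorem sum_sign_mul_kronecker : ∑ σ : Equiv.Perm (Fin 5), (Equiv.Perm.sign σ : ℤ) *
    (((if σ 0 = 0 then 1 else 0) * (if σ 1 = 1 then 1 else 0) -
      (if σ 0 = 1 then 1 else 0) * (if σ 1 = 0 then 1 else 0)) * (if σ 2 = 2 then 1 else 0) *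
      (if σ 3 = 3 then 1 else 0) * (if σ 4 = 4 then 1 else 0)) = 2 := by
  decide +kernel

variable (K) in
theorem not_isTrivialIdentity_quinticPoly (h2 : (2 : K) ≠ 0) :
    ¬ IsTrivialIdentity (quinticPoly K) := by
  intro h
  let b : ℕ → Fin 9 → K := fun i k => if (k : ℕ) = i then 1 else 0
  have hb : ∀ i : Fin 5, b i 5 = 0 ∧ b i 6 = 0 ∧ b i 7 = 0 := by
    intro i
    fin_cases i <;> simp [b]
  let π : BilinAlg (chainMul K) →ₗ[K] K := (LinearMap.proj 8 : (Fin 9 → K) →ₗ[K] K)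
  let a : ℕ → BilinAlg (chainMul K) := b
  have hπ : ∀ i j k l m : Fin 5,
      π (a i * a j * a k * a l * a m + a i * a j * a k * (a l * a m)) =
      ((((if i = 0 then 1 else 0) * (if j = 1 then 1 else 0) -
        (if i = 1 then 1 else 0) * (if j = 0 then 1 else 0)) * (if k = 2 then 1 else 0) *
        (if l = 3 then 1 else 0) * (if m = 4 then 1 else 0) : ℤ) : K) := by
    intro i j k l m
    refine (chainMul_word (b i) (b j) (b k) (b l) (b m) (hb i) (hb j) (hb k) (hb l) (hb m)).trans ?_
    have hd : ∀ (i p : Fin 5) (q : Fin 9), (q : ℕ) = p →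
        b i q = (((if i = p then 1 else 0 : ℤ)) : K) := by
      intro i p q hq
      simp only [b, hq, Fin.ext_iff, eq_comm (a := (p : ℕ)), Int.cast_ite, Int.cast_one,
        Int.cast_zero]
    rw [hd i 0 0 rfl, hd i 1 1 rfl, hd j 0 0 rfl, hd j 1 1 rfl, hd k 2 2 rfl, hd l 3 3 rfl,
      hd m 4 4 rfl]
    push_cast
    rfl
  have h' := congrArg π ((lift_quinticPoly a).symm.trans
    (h (BilinAlg (chainMul K)) chainMul_self a))
  simp only [altSum, map_sum, map_zsmul, map_zero, hπ, zsmul_eq_mul] at h'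
  have hs := congrArg (Int.cast : ℤ → K) sum_sign_mul_kronecker
  rw [Int.cast_sum] at hs
  simp only [Int.cast_mul] at hs h'
  refine h2 ?_
  rw [← Int.cast_two, ← hs]
  exact h'

theorem length_of_mem_support_quinticPoly {m : FreeMagma ℕ}
    (hm : m ∈ (quinticPoly K).coeff.support) : m.length = 5 := by
  by_contra h
  refine Finsupp.mem_support_iff.1 hm ?_
  have hs : ∀ p : FreeMagma ℕ, p.length = 5 →
      (MonoidAlgebra.single p (1 : K)).coeff m = 0 := by
    intro p hp
    rw [MonoidAlgebra.coeff_single, Finsupp.single_eq_of_ne]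
    rintro rfl
    exact h hp
  have hv : ∀ i : ℕ, var K i = MonoidAlgebra.single (FreeMagma.of i) 1 := fun _ => rfl
  simp only [quinticPoly, hv, MonoidAlgebra.single_mul_single, mul_one, MonoidAlgebra.coeff_sum,
    MonoidAlgebra.coeff_smul, MonoidAlgebra.coeff_add, Finsupp.coe_finsetSum, Finset.sum_apply,
    Finsupp.coe_smul, Finsupp.coe_add, Pi.smul_apply, Pi.add_apply]
  refine Finset.sum_eq_zero fun σ _ => ?_
  rw [hs _ rfl, hs _ rfl, add_zero, smul_zero]

theorem degree_quinticPoly (h2 : (2 : K) ≠ 0) : degree (quinticPoly K) = 5 := by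
  have h0 : quinticPoly K ≠ 0 := by
    intro h
    refine not_isTrivialIdentity_quinticPoly K h2 fun A _ _ _ _ _ a => ?_
    rw [h, map_zero]
  have hne : (quinticPoly K).coeff.support.Nonempty := by
    rw [Finsupp.support_nonempty_iff]
    exact fun h => h0 (MonoidAlgebra.ext h)
  refine le_antisymm (Finset.sup_le fun m hm => (length_of_mem_support_quinticPoly hm).le) ?_
  obtain ⟨m, hm⟩ := hne
  exact (length_of_mem_support_quinticPoly hm).ge.trans (Finset.le_sup (f := FreeMagma.length) hm)

end Quintic

/-! ### Failure of the named identities of low degree -/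

section Counterexamples

variable {K : Type u} [Field K]

theorem HoldsInOmegaLieAlgebras.lift_cyclicAlg {f : Poly K}
    (hf : HoldsInOmegaLieAlgebras.{u, v} f) (a : ℕ → CyclicAlg K) :
    FreeNonUnitalNonAssocAlgebra.lift K a f = 0 :=
  hf.satisfies (isOmegaLieAlgebra_cyclicAlg K) a

theorem not_holdsInOmegaLieAlgebras_engelPoly :
    ¬ HoldsInOmegaLieAlgebras.{u, v} (engelPoly K) := by
  intro h
  have h' := h.lift_cyclicAlg fun i => if i = 0 then e₀ K else e₃ K
  simp only [engelPoly, map_mul, FreeNonUnitalNonAssocAlgebra.lift_of_apply, if_true, one_ne_zero,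
    if_false, e₃_mul_e₀] at h'
  obtain ⟨-, -, -, h1⟩ := cyclicAlg_linearIndependent (a := 0) (b := 0) (c := 0) (d := (1 : K))
    (by rw [h']; simp)
  exact one_ne_zero h1

theorem not_holdsInOmegaLieAlgebras_threeParamPoly {α β γ : K}
    (h0 : ¬ (α = 0 ∧ β = 0 ∧ γ = 0)) :
    ¬ HoldsInOmegaLieAlgebras.{u, v} (threeParamPoly K α β γ) := by
  intro h
  have h' := h.lift_cyclicAlg fun i => if i = 0 then e₀ K else if i = 1 then e₁ K else e₂ K
  simp only [threeParamPoly, map_mul, map_add, map_sub, map_smul,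
    FreeNonUnitalNonAssocAlgebra.lift_of_apply, if_true, one_ne_zero, OfNat.ofNat_ne_zero,
    OfNat.ofNat_ne_one, if_false] at h'
  obtain ⟨h1, h2, h3, -⟩ := cyclicAlg_linearIndependent (a := γ) (b := -β) (c := α - γ) (d := 0)
    (by
      refine Eq.trans ?_ h'
      simp
      module)
  rw [neg_eq_zero] at h2
  rw [h1, sub_zero] at h3
  exact h0 ⟨h3, h2, h1⟩

theorem not_holdsInOmegaLieAlgebras_binaryLiePoly :
    ¬ HoldsInOmegaLieAlgebras.{u, v} (binaryLiePoly K) := by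
  intro h
  -- The summand `e₃` puts the product [x, y] = e₀ - e₃ outside the span of x and y; with y = e₁
  -- alone it would be x itself and the Jacobian would vanish.
  have h' := h.lift_cyclicAlg fun i => if i = 0 then e₀ K else e₁ K + e₃ K
  simp only [binaryLiePoly, jacobian, map_mul, map_add,
    FreeNonUnitalNonAssocAlgebra.lift_of_apply, if_true, one_ne_zero, if_false] at h'
  obtain ⟨-, -, -, h1⟩ := cyclicAlg_linearIndependent (a := 0) (b := 0) (c := 0) (d := (1 : K))
    (by
      refine Eq.trans ?_ h'
      simp [mul_add, add_mul])
  exact one_ne_zero h1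

theorem not_holdsInOmegaLieAlgebras_alternatingJacobianPoly (h2 : (2 : K) ≠ 0)
    (h3 : (3 : K) ≠ 0) : ¬ HoldsInOmegaLieAlgebras.{u, v} (alternatingJacobianPoly K) := by
  intro h
  have h' := h.lift_cyclicAlg fun i =>
    if i = 0 then e₀ K else if i = 1 then e₁ K else if i = 2 then e₂ K else e₃ K
  simp only [alternatingJacobianPoly, jacobian, map_mul, map_add, map_sub,
    FreeNonUnitalNonAssocAlgebra.lift_of_apply, if_true, one_ne_zero, OfNat.ofNat_ne_zero,
    OfNat.ofNat_ne_one, Nat.reduceEqDiff, if_false] at h'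
  -- The term [J(e₀, e₁, e₂), e₃] equals 3e₃ and each of the other three signed terms equals e₃,
  -- which gives 6e₃.
  obtain ⟨-, -, -, h1⟩ := cyclicAlg_linearIndependent (a := 0) (b := 0) (c := 0)
    (d := (2 * 3 : K))
    (by
      refine Eq.trans ?_ h'
      simp [add_mul]
      module)
  exact mul_ne_zero h2 h3 h1

end Counterexamples

end OmegaLie

theorem proposition10p1 (K : Type u) [Field K] (h2 : ringChar K ≠ 2) (h3 : ringChar K ≠ 3) :
    -- the minimal degree of a nontrivial identity of all `ω`-Lie algebras is `5`
    IsLeast {n : ℕ | ∃ f : OmegaLie.Poly K, ¬ OmegaLie.IsTrivialIdentity f ∧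
        OmegaLie.degree f = n ∧ OmegaLie.HoldsInOmegaLieAlgebras.{u, v} f} 5 ∧
    -- the explicit identity of degree `5`
    (¬ OmegaLie.IsTrivialIdentity (OmegaLie.quinticPoly K) ∧
      OmegaLie.degree (OmegaLie.quinticPoly K) = 5 ∧
      OmegaLie.HoldsInOmegaLieAlgebras.{u, v} (OmegaLie.quinticPoly K)) ∧
    -- each of the irreducible identities of degree at most `4` fails in some `ω`-Lie algebra
    ¬ OmegaLie.HoldsInOmegaLieAlgebras.{u, v} (OmegaLie.engelPoly K) ∧
    (∀ α β γ : K, ¬ (α = 0 ∧ β = 0 ∧ γ = 0) →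
      ¬ OmegaLie.HoldsInOmegaLieAlgebras.{u, v} (OmegaLie.threeParamPoly K α β γ)) ∧
    ¬ OmegaLie.HoldsInOmegaLieAlgebras.{u, v} (OmegaLie.binaryLiePoly K) ∧
    ¬ OmegaLie.HoldsInOmegaLieAlgebras.{u, v} (OmegaLie.alternatingJacobianPoly K) := by
  have h2' : (2 : K) ≠ 0 := Ring.two_ne_zero h2
  have h3' : (3 : K) ≠ 0 := by
    intro h
    have hd : ringChar K ∣ 3 := ringChar.dvd (by exact_mod_cast h)
    rcases (Nat.dvd_prime Nat.prime_three).1 hd with h1 | h1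
    · exact CharP.ringChar_ne_one h1
    · exact h3 h1
  have hq := And.intro (OmegaLie.not_isTrivialIdentity_quinticPoly K h2')
    (And.intro (OmegaLie.degree_quinticPoly h2')
      (OmegaLie.holdsInOmegaLieAlgebras_quinticPoly.{u, v} h3'))
  refine ⟨⟨⟨_, hq⟩, ?_⟩, hq, OmegaLie.not_holdsInOmegaLieAlgebras_engelPoly,
    fun α β γ => OmegaLie.not_holdsInOmegaLieAlgebras_threeParamPoly,
    OmegaLie.not_holdsInOmegaLieAlgebras_binaryLiePoly,
    OmegaLie.not_holdsInOmegaLieAlgebras_alternatingJacobianPoly h2' h3'⟩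
  rintro n ⟨f, hf, hn, hH⟩
  by_contra hlt
  exact hf (OmegaLie.isTrivialIdentity_of_satisfies_cyclicAlg h2' h3' (by omega)
    (hH.satisfies (OmegaLie.isOmegaLieAlgebra_cyclicAlg K)))
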